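/- A \emph{bar partition} is an integer partition with pairwise distinct parts. Let $M=\{(q_1,q_2,q_3)\in\mathbb Z^3 : q_1+q_2+q_3=0\}$. For $q\in M$ define $$m_2=|q_1|,\qquad (m_1,m_{-1})=\begin{cases}(|q_2|,0)&\text{if } q_2\le 0\\ (0,|q_2|)&\text{if } q_2>0,\end{cases}\qquad m_0=\begin{cases}q_1+q_2&\text{if } q_1+q_2\ge 0\\ -(q_1+q_2)-1&\text{if } q_1+q_2<0,\end{cases}$$ and let $\lambda(q)$ be the unique bar partition such that (i) for each $i\in\{0,1,2,-1\}$, exactly $m_i$ parts of $\lambda(q)$ are congruent to $i$ modulo $4$, and (ii) whenever $k>4$ is a part of $\lambda(q)$, so is $k-4$. For $N\in\mathbb Z_{\ge 0}$ let $\mathcal D_4^\flat(N)$ (the Lecouvey--Wahiche model in type $D_4^{(3)}$) be the set of partitions of $N$ of the form $\lambda(q)$ with $q\in M$, and let $\mathcal U(k)=\{(x,y)\in\mathbb Z^2 : x^2+3y^2=k\}$. Then for all $N\in\mathbb Z_{\ge 0}$, the set $\mathcal U(12N+7)$ is finite and $$|\mathcal D_4^\flat(N)|=\tfrac14\,|\mathcal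 U(12N+7)|.$$ -/

import Mathlib

namespace D43

/-- The lattice `M` of type `D_4^{(3)}`: integer vectors `q = q₁ε₁ + q₂ε₂ + q₃ε₃` with
`q₁ + q₂ + q₃ = 0` (the coordinates `q₁, q₂, q₃` are `q 0, q 1, q 2`). -/
def latticeM : Set (Fin 3 → ℤ) := {q | q 0 + q 1 + q 2 = 0}

/-- The prescribed number of parts congruent to `2` modulo `4`: `|q₁|`. -/
def m2 (q : Fin 3 → ℤ) : ℤ := |q 0|

/-- The prescribed number of parts congruent to `1` modulo `4`. -/
def m1 (q : Fin 3 → ℤ) : ℤ := if q 1 ≤ 0 then |q 1| else 0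

/-- The prescribed number of parts congruent to `-1` modulo `4`. -/
def mNeg1 (q : Fin 3 → ℤ) : ℤ := if q 1 ≤ 0 then 0 else |q 1|

/-- The prescribed number of parts congruent to `0` modulo `4`. -/
def m0 (q : Fin 3 → ℤ) : ℤ := if 0 ≤ q 0 + q 1 then q 0 + q 1 else -(q 0 + q 1) - 1

/-- A bar partition is a partition with pairwise distinct parts. -/
def IsBar {N : ℕ} (p : N.Partition) : Prop := p.parts.Nodup

/-- The number of `i`-parts of `p`: parts (they are all nonzero) congruent to `i` modulo `4`. -/
def numParts {N : ℕ} (p : N.Partition) (i : ZMod 4) : ℕ :=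
  p.parts.countP (fun k : ℕ => (k : ZMod 4) = i)

/-- `p` is the bar partition constructed from `q`: it has `mᵢ` parts congruent to `i` modulo `4`,
and whenever `k` is a part with `k - 4 > 0`, also `k - 4` is a part. -/
structure IsBuiltFrom {N : ℕ} (q : Fin 3 → ℤ) (p : N.Partition) : Prop where
  bar : IsBar p
  num_zero : (numParts p 0 : ℤ) = m0 q
  num_one : (numParts p 1 : ℤ) = m1 q
  num_two : (numParts p 2 : ℤ) = m2 q
  num_neg_one : (numParts p (-1) : ℤ) = mNeg1 q
  sub_four_mem : ∀ k ∈ p.parts, 4 < k → k - 4 ∈ p.parts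

/-- `𝒟₄^♭(N)`: the partitions of size `N` constructed from the elements of `M`. -/
def DFlat (N : ℕ) : Set N.Partition := {p | ∃ q ∈ latticeM, IsBuiltFrom q p}

/-- `𝒰(k)`: the integer solutions `(x, y)` of `x² + 3y² = k`. -/
def solutions (k : ℤ) : Set (ℤ × ℤ) := {z | z.1 ^ 2 + 3 * z.2 ^ 2 = k}

end D43

namespace D43

open Finset

/-! A set of positive integers closed under subtracting 4 is fixed by its four residue counts
(`eq_blocks_iff`), so λ(q) has a size quadratic in `q 0`, `q 1` (`sum_blocks_multiplicity`), and q ↦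
λ(q) is injective (`multiplicity_injOn`). Completing squares turns size N into x² + 3y² = 12N + 7
with x = 6b + 2, y = 4a + 2b + 1 (`mem_latticePoints_iff`). Each solution has exactly one sign
change of this shape, whence the factor 4 (`ncard_solutions`). -/

/-- The set of the numbers `4 * j + i + 1` with `i < 4` and `j < f i`. -/
def blocks (f : Fin 4 → ℕ) : Finset ℕ :=
  (univ.sigma fun i => range (f i)).image fun x => 4 * x.2 + x.1 + 1

lemma mem_blocks {f : Fin 4 → ℕ} {k : ℕ} :
    k ∈ blocks f ↔ ∃ i : Fin 4, ∃ j < f i, 4 * j + i + 1 = k := by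
  simp [blocks]

lemma mem_blocks_iff {f : Fin 4 → ℕ} {i : Fin 4} {j : ℕ} :
    4 * j + i + 1 ∈ blocks f ↔ j < f i := by
  rw [mem_blocks]
  constructor
  · rintro ⟨i', j', h, e⟩
    have hi : i' = i := by ext; omega
    subst hi
    have hj : j' = j := by omega
    rwa [← hj]
  · intro h
    exact ⟨i, j, h, rfl⟩

lemma cast_eq_iff (k : ℕ) (i : Fin 4) :
    ((k : ZMod 4) = ((i + 1 : ℕ) : ZMod 4)) ↔ k % 4 = (i + 1) % 4 :=
  ZMod.natCast_eq_natCast_iff' _ _ _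

lemma exists_eq_of_pos {k : ℕ} (hk : 0 < k) : ∃ (i : Fin 4) (j : ℕ), 4 * j + i + 1 = k :=
  ⟨⟨(k - 1) % 4, by omega⟩, (k - 1) / 4, by simp only; omega⟩

lemma sum_blocks (f : Fin 4 → ℕ) :
    ∑ k ∈ blocks f, k = ∑ i : Fin 4, ∑ j ∈ range (f i), (4 * j + i + 1) := by
  rw [blocks, sum_image, sum_sigma]
  rintro ⟨i, j⟩ - ⟨i', j'⟩ - h
  simp only at h
  have hi : i = i' := by ext; omega
  subst hi
  have hj : j = j' := by omega
  rw [hj]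

lemma sum_progression (n c : ℕ) :
    ((∑ j ∈ range n, (4 * j + c + 1) : ℕ) : ℤ) = 2 * n ^ 2 + (c - 1) * n := by
  induction n with
  | zero => simp
  | succ n ih =>
    rw [sum_range_succ, Nat.cast_add, ih]
    push_cast
    ring

lemma eq_range_card {t : Finset ℕ} (h : ∀ j, j + 1 ∈ t → j ∈ t) : t = range t.card := by
  have down : ∀ d j, j + d ∈ t → j ∈ t := by
    intro d
    induction d with
    | zero => exact fun j hj => hj
    | succ d ih => exact fun j hj => ih j (h _ hj)
  refine eq_of_subset_of_card_le (fun j hj => ?_) (by simp)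
  have hsub : range (j + 1) ⊆ t := fun i hi => by
    obtain ⟨d, rfl⟩ := Nat.exists_eq_add_of_le (Nat.lt_succ_iff.mp (mem_range.mp hi))
    exact down d i hj
  simpa using card_le_card hsub

/-- Membership in a set of positive numbers closed under subtracting `4`, in terms of the sizes of
its residue classes. -/
lemma mem_iff_lt_card {s : Finset ℕ} (h0 : 0 ∉ s) (h : ∀ k ∈ s, 4 < k → k - 4 ∈ s)
    (i : Fin 4) (j : ℕ) :
    4 * j + i + 1 ∈ s ↔
      j < #{k ∈ s | ((k : ℕ) : ZMod 4) = ((i + 1 : ℕ) : ZMod 4)} := by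
  have hinj : Function.Injective fun j : ℕ => 4 * j + (i : ℕ) + 1 := fun a b hab => by
    simp only at hab
    omega
  -- Along each residue class, closure under subtracting 4 makes the indices an initial segment of
  -- ℕ.
  have hdown := eq_range_card (t := s.preimage _ hinj.injOn) fun j hj => by
    rw [mem_preimage] at hj ⊢
    have := h _ hj (by omega)
    rwa [show 4 * (j + 1) + (i : ℕ) + 1 - 4 = 4 * j + i + 1 by omega] at this
  have hcard : #(s.preimage _ hinj.injOn) =
      #{k ∈ s | ((k : ℕ) : ZMod 4) = ((i + 1 : ℕ) : ZMod 4)} := by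
    rw [← card_image_of_injective _ hinj]
    congr 1
    ext k
    simp only [mem_image, mem_preimage, mem_filter, cast_eq_iff]
    constructor
    · rintro ⟨j, hj, rfl⟩
      exact ⟨hj, by omega⟩
    · rintro ⟨hk, hmod⟩
      have hpos : 0 < k := Nat.pos_of_ne_zero fun e => h0 (e ▸ hk)
      have e : 4 * ((k - 1) / 4) + (i : ℕ) + 1 = k := by omega
      exact ⟨(k - 1) / 4, by rwa [e], e⟩
  rw [← hcard, ← mem_range, ← hdown, mem_preimage]

lemma zero_notMem_blocks (f : Fin 4 → ℕ) : 0 ∉ blocks f := by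
  simp [mem_blocks]

lemma sub_four_mem_blocks (f : Fin 4 → ℕ) : ∀ k ∈ blocks f, 4 < k → k - 4 ∈ blocks f := by
  intro k hk h4
  obtain ⟨i, j, hj, rfl⟩ := mem_blocks.mp hk
  rw [show 4 * j + (i : ℕ) + 1 - 4 = 4 * (j - 1) + i + 1 by omega, mem_blocks_iff]
  omega

lemma card_filter_blocks (f : Fin 4 → ℕ) (i : Fin 4) :
    #{k ∈ blocks f | ((k : ℕ) : ZMod 4) = ((i + 1 : ℕ) : ZMod 4)} = f i :=
  eq_of_forall_lt_iff fun j => by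
    rw [← mem_iff_lt_card (zero_notMem_blocks f) (sub_four_mem_blocks f), mem_blocks_iff]

/-- A set of positive numbers closed under subtracting `4` is determined by the sizes of its
residue classes. -/
lemma eq_blocks_iff {s : Finset ℕ} (h0 : 0 ∉ s) (f : Fin 4 → ℕ) :
    s = blocks f ↔ (∀ k ∈ s, 4 < k → k - 4 ∈ s) ∧
      ∀ i : Fin 4, #{k ∈ s | ((k : ℕ) : ZMod 4) = ((i + 1 : ℕ) : ZMod 4)} = f i := by
  constructor
  · rintro rfl
    exact ⟨sub_four_mem_blocks f, card_filter_blocks f⟩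
  · rintro ⟨h, hf⟩
    ext k
    rcases Nat.eq_zero_or_pos k with rfl | hk
    · simp [h0, zero_notMem_blocks]
    · obtain ⟨i, j, rfl⟩ := exists_eq_of_pos hk
      rw [mem_iff_lt_card h0 h, mem_blocks_iff, hf]

lemma blocks_injective : Function.Injective blocks := fun f g h => by
  ext i
  rw [← card_filter_blocks f, h, card_filter_blocks]

/-! ### Partitions built from lattice vectors -/

/-- The numbers of parts congruent to `1, 2, 3, 0` modulo `4` prescribed by `q`. -/
def multiplicity (q : Fin 3 → ℤ) : Fin 4 → ℕ :=
  ![(m1 q).toNat, (m2 q).toNat, (mNeg1 q).toNat, (m0 q).toNat]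

lemma m1_nonneg (q : Fin 3 → ℤ) : 0 ≤ m1 q := by unfold m1; split_ifs <;> positivity
lemma m2_nonneg (q : Fin 3 → ℤ) : 0 ≤ m2 q := abs_nonneg _
lemma mNeg1_nonneg (q : Fin 3 → ℤ) : 0 ≤ mNeg1 q := by unfold mNeg1; split_ifs <;> positivity
lemma m0_nonneg (q : Fin 3 → ℤ) : 0 ≤ m0 q := by unfold m0; split_ifs <;> omega

lemma zero_notMem_parts {N : ℕ} (p : N.Partition) : 0 ∉ p.parts.toFinset := fun h =>
  (p.parts_pos (Multiset.mem_toFinset.mp h)).ne' rfl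

lemma numParts_eq_card {N : ℕ} {p : N.Partition} (hp : IsBar p) (i : ZMod 4) :
    numParts p i = #{k ∈ p.parts.toFinset | ((k : ℕ) : ZMod 4) = i} := by
  rw [numParts, Multiset.countP_eq_card_filter, card_def, filter_val, Multiset.toFinset_val,
    Multiset.dedup_eq_self.mpr hp]

lemma isBuiltFrom_iff {N : ℕ} (q : Fin 3 → ℤ) (p : N.Partition) :
    IsBuiltFrom q p ↔ p.parts = (blocks (multiplicity q)).val := by
  have key (hp : IsBar p) : p.parts = (blocks (multiplicity q)).val ↔
      p.parts.toFinset = blocks (multiplicity q) := by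
    rw [← val_inj, Multiset.toFinset_val, Multiset.dedup_eq_self.mpr hp]
  -- Index `i` stands for residue `i + 1`, so multiples of 4 start at 4 rather than 0.
  have h4 : (4 : ZMod 4) = 0 := rfl
  have h3 : (3 : ZMod 4) = -1 := rfl
  have a := m0_nonneg q
  have b := m1_nonneg q
  have c := m2_nonneg q
  have d := mNeg1_nonneg q
  constructor
  · intro h
    rw [key h.bar, eq_blocks_iff (zero_notMem_parts p)]
    refine ⟨by simpa using h.sub_four_mem, fun i => ?_⟩
    rw [← numParts_eq_card h.bar]
    have e0 := h.num_zero
    have e1 := h.num_one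
    have e2 := h.num_two
    have e3 := h.num_neg_one
    fin_cases i <;> simp [multiplicity, h4, h3] <;> omega
  · intro h
    have bar : IsBar p := by rw [IsBar, h]; exact nodup _
    rw [key bar, eq_blocks_iff (zero_notMem_parts p)] at h
    obtain ⟨hs, hc⟩ := h
    simp only [← numParts_eq_card bar] at hc
    have e0 := hc 3
    have e1 := hc 0
    have e2 := hc 1
    have e3 := hc 2
    simp [multiplicity, h4, h3] at e0 e1 e2 e3
    exact ⟨bar, by omega, by omega, by omega, by omega, by simpa using hs⟩

/-- Both cases of each definition agree: residues ±1 contribute 2b² + b for either sign of b = `q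
1`, and 2n² + 2n is invariant under n ↦ -n - 1. -/
lemma sum_blocks_multiplicity (q : Fin 3 → ℤ) :
    ((∑ k ∈ blocks (multiplicity q), k : ℕ) : ℤ) =
      4 * q 0 ^ 2 + 4 * q 1 ^ 2 + 4 * q 0 * q 1 + 2 * q 0 + 3 * q 1 := by
  rw [sum_blocks, Nat.cast_sum]
  simp only [sum_progression, Fin.sum_univ_four]
  simp only [multiplicity, Matrix.cons_val, Int.toNat_of_nonneg (m0_nonneg q),
    Int.toNat_of_nonneg (m1_nonneg q), Int.toNat_of_nonneg (m2_nonneg q),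
    Int.toNat_of_nonneg (mNeg1_nonneg q)]
  simp only [m0, m1, m2, mNeg1, sq_abs]
  norm_num
  split_ifs with h1 h2 h2
  · rw [abs_of_nonpos h1]; ring
  · rw [abs_of_nonpos h1]; ring
  · rw [abs_of_pos (not_le.mp h1)]; ring
  · rw [abs_of_pos (not_le.mp h1)]; ring

/-- Different vectors of the lattice prescribe different multiplicities. -/
lemma multiplicity_injOn {q r : Fin 3 → ℤ} (h : multiplicity q = multiplicity r) :
    q 0 = r 0 ∧ q 1 = r 1 := by
  have e0 := congrFun h 3
  have e1 := congrFun h 0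
  have e2 := congrFun h 1
  have e3 := congrFun h 2
  simp only [multiplicity, Matrix.cons_val] at e0 e1 e2 e3
  simp only [m0, m1, m2, mNeg1, abs_eq_max_neg] at e0 e1 e2 e3
  -- `q 1` and `|q 0|` are read off. If `q 0` changed sign, equal `m0` would force `q 0 = 0` or `2 *
  -- q 1 = -1`.
  split_ifs at e0 e1 e3 <;> omega

/-- The pairs `(q₁, q₂)` whose partition has size `N`. -/
def latticePoints (N : ℕ) : Set (ℤ × ℤ) :=
  {z | 4 * z.1 ^ 2 + 4 * z.2 ^ 2 + 4 * z.1 * z.2 + 2 * z.1 + 3 * z.2 = N}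

lemma ncard_DFlat (N : ℕ) : (DFlat N).ncard = (latticePoints N).ncard := by
  symm
  let v (z : ℤ × ℤ) : Fin 3 → ℤ := ![z.1, z.2, -(z.1 + z.2)]
  have hsum (z : ℤ × ℤ) (hz : z ∈ latticePoints N) :
      (blocks (multiplicity (v z))).val.sum = N := by
    have h := sum_blocks_multiplicity (v z)
    rw [sum_val]
    exact Nat.cast_injective (R := ℤ) (h.trans hz)
  refine Set.ncard_congr (fun z hz => ⟨(blocks (multiplicity (v z))).val, fun {k} hk => ?_,
    hsum z hz⟩) ?_ ?_ ?_
  · exact Nat.pos_of_ne_zero fun e => zero_notMem_blocks _ (e ▸ hk)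
  · intro z hz
    exact ⟨v z, by simp [v, latticeM], (isBuiltFrom_iff _ _).mpr rfl⟩
  · intro z w hz hw h
    have h' := multiplicity_injOn (blocks_injective (val_inj.mp (congrArg Nat.Partition.parts h)))
    exact Prod.ext h'.1 h'.2
  · rintro p ⟨q, hq, hp⟩
    rw [isBuiltFrom_iff] at hp
    have hv : v (q 0, q 1) = q := by
      have hq : q 0 + q 1 + q 2 = 0 := hq
      ext i
      fin_cases i
      · rfl
      · rfl
      · change -(q 0 + q 1) = q 2
        omega
    refine ⟨(q 0, q 1), ?_, ?_⟩
    · change _ = _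
      rw [← sum_blocks_multiplicity, ← p.parts_sum, hp, sum_val]
      rfl
    · ext1
      change (blocks (multiplicity (v (q 0, q 1)))).val = p.parts
      rw [hp, hv]

/-! ### Solutions of the quadratic equation -/

lemma solutions_finite (k : ℤ) : (solutions k).Finite := by
  refine ((Set.finite_Icc (-k) k).prod (Set.finite_Icc (-k) k)).subset ?_
  rintro ⟨x, y⟩ h
  have h : x ^ 2 + 3 * y ^ 2 = k := h
  have hx : |x| ≤ x ^ 2 := by rw [← sq_abs]; exact Int.le_self_sq _
  have hy : |y| ≤ y ^ 2 := by rw [← sq_abs]; exact Int.le_self_sq _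
  exact ⟨abs_le.mp (by nlinarith [sq_nonneg y]), abs_le.mp (by nlinarith [sq_nonneg x])⟩

lemma mem_latticePoints_iff {N : ℕ} {a b : ℤ} :
    (a, b) ∈ latticePoints N ↔
      (6 * b + 2) ^ 2 + 3 * (4 * a + 2 * b + 1) ^ 2 = 12 * (N : ℤ) + 7 := by
  change _ = _ ↔ _
  constructor <;> intro h <;> linarith

/-- Modulo 3, x² ≡ 1; modulo 4, x² - y² ≡ 3, so x is even and y odd. -/
lemma residues_of_mem_solutions {N : ℕ} {x y : ℤ}
    (h : x ^ 2 + 3 * y ^ 2 = 12 * (N : ℤ) + 7) : (x % 6 = 2 ∨ x % 6 = 4) ∧ y % 2 = 1 := by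
  have h3 : (x ^ 2 + 3 * y ^ 2) % 12 = 7 := by omega
  have hx : x % 12 = 0 ∨ x % 12 = 1 ∨ x % 12 = 2 ∨ x % 12 = 3 ∨ x % 12 = 4 ∨ x % 12 = 5 ∨
    x % 12 = 6 ∨ x % 12 = 7 ∨ x % 12 = 8 ∨ x % 12 = 9 ∨ x % 12 = 10 ∨ x % 12 = 11 := by omega
  have hy : y % 4 = 0 ∨ y % 4 = 1 ∨ y % 4 = 2 ∨ y % 4 = 3 := by omega
  have hy2 : 3 * y ^ 2 % 12 = 3 * ((y % 4) ^ 2 % 4) := by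
    rw [show (12 : ℤ) = 3 * 4 by norm_num, Int.mul_emod_mul_of_pos _ _ (by norm_num)]
    congr 1
    exact (Int.ModEq.pow 2 (Int.mod_modEq y 4)).symm
  have hx2 : x ^ 2 % 12 = (x % 12) ^ 2 % 12 := (Int.ModEq.pow 2 (Int.mod_modEq x 12)).symm
  rcases hy with hy | hy | hy | hy <;> rw [hy] at hy2 <;> norm_num at hy2 <;>
    rcases hx with hx | hx | hx | hx | hx | hx | hx | hx | hx | hx | hx | hx <;>
    rw [hx] at hx2 <;> norm_num at hx2 <;> omega

/-- The sign changes act freely on the solutions, with the lattice points as representatives. -/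
lemma ncard_solutions (N : ℕ) :
    (solutions (12 * (N : ℤ) + 7)).ncard = 4 * (latticePoints N).ncard := by
  have hcard : ((Set.univ : Set (ℤˣ × ℤˣ)) ×ˢ latticePoints N).ncard =
      4 * (latticePoints N).ncard := by
    rw [Set.ncard_prod, Set.ncard_univ]
    simp
  rw [← hcard]
  symm
  refine Set.ncard_congr
    (fun w _ => (w.1.1 * (6 * w.2.2 + 2), w.1.2 * (4 * w.2.1 + 2 * w.2.2 + 1))) ?_ ?_ ?_
  · rintro ⟨⟨e, d⟩, a, b⟩ ⟨-, h⟩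
    rw [mem_latticePoints_iff] at h
    rcases Int.units_eq_one_or e with rfl | rfl <;> rcases Int.units_eq_one_or d with rfl | rfl <;>
      simpa only [solutions, Set.mem_ofPred_eq, Units.val_neg, Units.val_one, neg_mul, one_mul, neg_sq]
        using h
  · rintro ⟨⟨e, d⟩, a, b⟩ ⟨⟨e', d'⟩, a', b'⟩ - - h
    simp only [Prod.mk.injEq] at h ⊢
    obtain ⟨h1, h2⟩ := h
    -- Opposite signs clash modulo 6 in the first coordinate, then modulo 4 in the second.
    rcases Int.units_eq_one_or e with rfl | rfl <;> rcases Int.units_eq_one_or d with rfl | rfl <;>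
      rcases Int.units_eq_one_or e' with rfl | rfl <;>
      rcases Int.units_eq_one_or d' with rfl | rfl <;>
      simp only [Units.val_one, Units.val_neg, one_mul, neg_mul] at h1 h2 <;>
      first
        | exact ⟨⟨rfl, rfl⟩, by omega, by omega⟩
        | (exfalso; omega)
  · rintro ⟨x, y⟩ h
    have h : x ^ 2 + 3 * y ^ 2 = 12 * (N : ℤ) + 7 := h
    obtain ⟨hx, hy⟩ := residues_of_mem_solutions h
    obtain ⟨e, b, rfl⟩ : ∃ (e : ℤˣ) (b : ℤ), e * (6 * b + 2) = x := by
      rcases hx with hx | hx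
      · exact ⟨1, x / 6, by simp only [Units.val_one]; omega⟩
      · exact ⟨-1, -x / 6, by simp only [Units.val_neg, Units.val_one]; omega⟩
    -- As y and 2b + 1 are odd, one of ±y is ≡ 2b + 1 modulo 4.
    obtain ⟨d, a, rfl⟩ : ∃ (d : ℤˣ) (a : ℤ), d * (4 * a + 2 * b + 1) = y := by
      rcases (by omega : (y - (2 * b + 1)) % 4 = 0 ∨ (-y - (2 * b + 1)) % 4 = 0) with h | h
      · exact ⟨1, (y - (2 * b + 1)) / 4, by simp only [Units.val_one]; omega⟩
      · exact ⟨-1, (-y - (2 * b + 1)) / 4, by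
          simp only [Units.val_neg, Units.val_one]; omega⟩
    refine ⟨((e, d), a, b), ⟨Set.mem_univ _, mem_latticePoints_iff.mpr ?_⟩, rfl⟩
    rw [← h, mul_pow, mul_pow, ← Units.val_pow_eq_pow_val, ← Units.val_pow_eq_pow_val,
      Int.units_sq, Int.units_sq]
    simp

end D43

theorem mainTheorem8 (N : ℕ) :
    (D43.solutions (12 * (N : ℤ) + 7)).Finite ∧
      ((D43.DFlat N).ncard : ℚ) =
        (1 / 4 : ℚ) * ((D43.solutions (12 * (N : ℤ) + 7)).ncard : ℚ) := by
  refine ⟨D43.solutions_finite _, ?_⟩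
  rw [D43.ncard_DFlat, D43.ncard_solutions]
  push_cast
  ring
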